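/- Let $1\le m\le n$ be integers and let $p_1,\dots,p_n\in(0,\tfrac12]$. Let $A\in\mathbb F_2^{n\times n}$ and $b\in\mathbb F_2^n$ be random with all entries independent, where each entry of the $i$-th row of $A$ equals $1$ with probability $p_i$ and each entry of $b$ equals $1$ with probability $\tfrac12$, and let $h(x)=Ax+b$ for $x\in\{0,1\}^n=\mathbb F_2^n$. Let $h^{(m)}(x)$ denote the first $m$ coordinates of $h(x)$ and $\alpha^{(m)}$ those of $\alpha\in\{0,1\}^n$. For a nonempty set $S\subseteq\{0,1\}^n$ and $\alpha\in\{0,1\}^n$ put $$\mathsf{Cnt}_{S,m}=\bigl|\{y\in S : h^{(m)}(y)=\alpha^{(m)}\}\bigr| ,$$ and for integers $w\ge 0$ put $$r(w,m)=\prod_{j=1}^{m}\Bigl(\tfrac12+\tfrac12(1-2p_j)^w\Bigr)-\frac1{2^m},$$ with $0^0=1$. Then, for every nonempty $S\subseteq\{0,1\}^n$ and every $\alpha\in\{0,1\}^n$, $$\frac{\sigma^2[\mathsf{Cnt}_{S,m}]}{\mathsf E[\mathsf{Cnt}_{S,m}]}\;\le\;\sum_{w=0}^{\ell}2\left(\frac{8e\sqrt{n\ell}}{w}\right)^{w}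 r(w,m),\qquad \ell=\lceil\log_2|S|\rceil,$$ where for $w=0$ the factor $(8e\sqrt{n\ell}/w)^w$ is read as $1$. -/

import Mathlib

open MeasureTheory ProbabilityTheory

namespace SparseHash

/-- The probability `1/2` as a point of the unit interval. -/
noncomputable def half : unitInterval := ⟨1 / 2, by norm_num, by norm_num⟩

/-- Seeds of the family `h(x) = A x + b`: an `n × n` matrix `A` and a vector `b` over `𝔽₂`.
The matrix is a plain function of two indices, so that it carries the product σ-algebra. -/
abbrev Seed (n : ℕ) : Type := (Fin n → Fin n → ZMod 2) × (Fin n → ZMod 2)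

/-- The law of the random seed: all entries of `A` and `b` are independent, the entries of row `i`
of `A` are `1` with probability `p i` (else `0`), those of `b` are `1` with probability `1/2`. -/
noncomputable def seedLaw {n : ℕ} (p : Fin n → unitInterval) : Measure (Seed n) :=
  (Measure.pi fun i : Fin n => Measure.pi fun _ : Fin n =>
      bernoulliMeasure (1 : ZMod 2) 0 (p i)).prod
    (Measure.pi fun _ : Fin n => bernoulliMeasure (1 : ZMod 2) 0 half)

/-- The hash function `h(x) = A x + b`. -/
def hash {n : ℕ} (ω : Seed n) (x : Fin n → ZMod 2) : Fin n → ZMod 2 :=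
  (Matrix.of ω.1).mulVec x + ω.2

/-- The prefix slice: the first `m` coordinates of a vector of length `n`. -/
def slice {n m : ℕ} (hm : m ≤ n) (y : Fin n → ZMod 2) : Fin m → ZMod 2 :=
  fun i => y (Fin.castLE hm i)

/-- The cell of `S`: the elements of `S` whose hash agrees with `α` in the first `m` coordinates. -/
def cell {n m : ℕ} (hm : m ≤ n) (S : Finset (Fin n → ZMod 2)) (α : Fin n → ZMod 2)
    (ω : Seed n) : Finset (Fin n → ZMod 2) :=
  S.filter fun y => slice hm (hash ω y) = slice hm α

/-- The number of elements of the cell, as a real random variable on seeds. -/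
def cnt {n m : ℕ} (hm : m ≤ n) (S : Finset (Fin n → ZMod 2)) (α : Fin n → ZMod 2)
    (ω : Seed n) : ℝ :=
  ((cell hm S α ω).card : ℝ)

/-- `q(w,m) = ∏_{j ≤ m} (1/2 + (1/2)(1 - 2 p_j)^w)`, with `0 ^ 0 = 1`. -/
noncomputable def q {n m : ℕ} (p : Fin n → unitInterval) (hm : m ≤ n) (w : ℕ) : ℝ :=
  ∏ j : Fin m, (1 / 2 + 1 / 2 * (1 - 2 * (p (Fin.castLE hm j) : ℝ)) ^ w)

/-- `r(w,m) = q(w,m) - 2^{-m}`. -/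
noncomputable def r {n m : ℕ} (p : Fin n → unitInterval) (hm : m ≤ n) (w : ℕ) : ℝ :=
  q p hm w - 1 / 2 ^ m

/-- `ℓ = ⌈log₂ |S|⌉`. -/
noncomputable def ell {n : ℕ} (S : Finset (Fin n → ZMod 2)) : ℕ :=
  ⌈Real.logb 2 (S.card : ℝ)⌉₊

end SparseHash

namespace SparseHash

open Finset
open scoped symmDiff

section Combinatorics

open scoped FinsetFamily

variable {β : Type*}

lemma two_pow_card_le_of_mem {𝒜 : Finset (Finset β)} (h : IsLowerSet (𝒜 : Set (Finset β)))
    {s : Finset β} (hs : s ∈ 𝒜) : 2 ^ #s ≤ #𝒜 := by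
  rw [← card_powerset]
  exact card_le_card fun t ht => h (mem_powerset.1 ht) hs

variable [DecidableEq β]

/-- The sum of `g (d(s, t))` over all ordered pairs of members of a set family, where `d` is the
Hamming distance. -/
def energy (g : ℕ → ℝ) (𝒜 : Finset (Finset β)) : ℝ :=
  ∑ s ∈ 𝒜, ∑ t ∈ 𝒜, g (#(s ∆ t))

lemma sum_finset_split [Fintype β] {M : Type*} [AddCommMonoid M] (a : β) (F : Finset β → M) :
    ∑ s, F s = ∑ s ∈ (univ.erase a).powerset, (F s + F (insert a s)) := by
  rw [sum_add_distrib, ← sum_powerset_insert (notMem_erase a univ), insert_erase (mem_univ a),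
    powerset_univ]

lemma energy_eq_sum_univ [Fintype β] (g : ℕ → ℝ) (𝒜 : Finset (Finset β)) :
    energy g 𝒜 = ∑ s, ∑ t, if s ∈ 𝒜 ∧ t ∈ 𝒜 then g (#(s ∆ t)) else 0 := by
  simp [energy, ite_and]

lemma insert_symmDiff_insert {a : β} {s t : Finset β} (hs : a ∉ s) (ht : a ∉ t) :
    insert a s ∆ insert a t = s ∆ t := by
  ext x; simp only [mem_symmDiff, mem_insert]; grind

lemma card_insert_symmDiff {a : β} {s t : Finset β} (hs : a ∉ s) (ht : a ∉ t) :
    #(insert a s ∆ t) = #(s ∆ t) + 1 := by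
  rw [← card_insert_of_notMem (a := a) (s := s ∆ t) (by simp [mem_symmDiff, hs, ht])]
  congr 1
  ext x; simp only [mem_symmDiff, mem_insert]; grind

lemma mem_compression_of_notMem {a : β} {𝒜 : Finset (Finset β)} {s : Finset β} (hs : a ∉ s) :
    s ∈ 𝓓 a 𝒜 ↔ s ∈ 𝒜 ∨ insert a s ∈ 𝒜 := by
  rw [Down.mem_compression, erase_eq_of_notMem hs]; tauto

lemma insert_mem_compression {a : β} {𝒜 : Finset (Finset β)} {s : Finset β} (hs : a ∉ s) :
    insert a s ∈ 𝓓 a 𝒜 ↔ s ∈ 𝒜 ∧ insert a s ∈ 𝒜 := by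
  rw [Down.mem_compression, erase_insert hs, insert_idem]; tauto

lemma energy_le_energy_compression [Fintype β] {g : ℕ → ℝ} (hg : Antitone g) (a : β)
    (𝒜 : Finset (Finset β)) : energy g 𝒜 ≤ energy g (𝓓 a 𝒜) := by
  simp only [energy_eq_sum_univ]
  simp only [sum_finset_split a, ← sum_add_distrib]
  refine sum_le_sum fun s hs => sum_le_sum fun t ht => ?_
  have hs : a ∉ s := fun h => by simpa using mem_powerset.1 hs h
  have ht : a ∉ t := fun h => by simpa using mem_powerset.1 ht h
  have h1 : #(s ∆ insert a t) = #(s ∆ t) + 1 := by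
    rw [symmDiff_comm, card_insert_symmDiff ht hs, symmDiff_comm]
  have hle := hg (Nat.le_succ #(s ∆ t))
  rw [insert_symmDiff_insert hs ht, card_insert_symmDiff hs ht, h1]
  simp only [mem_compression_of_notMem hs, mem_compression_of_notMem ht,
    insert_mem_compression hs, insert_mem_compression ht]
  by_cases p1 : s ∈ 𝒜 <;> by_cases p2 : insert a s ∈ 𝒜 <;> by_cases p3 : t ∈ 𝒜 <;>
    by_cases p4 : insert a t ∈ 𝒜 <;> simp [p1, p2, p3, p4] <;> linarith

lemma sum_card_compression_lt [Fintype β] {a : β} {𝒜 : Finset (Finset β)} {s : Finset β}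
    (has : a ∉ s) (hs : s ∉ 𝒜) (hs' : insert a s ∈ 𝒜) :
    ∑ t ∈ 𝓓 a 𝒜, #t < ∑ t ∈ 𝒜, #t := by
  have key (ℬ : Finset (Finset β)) : ∑ t ∈ ℬ, #t = ∑ t, if t ∈ ℬ then #t else 0 := by
    simp
  rw [key, key, sum_finset_split a, sum_finset_split a]
  refine sum_lt_sum (fun t ht => ?_) ⟨s, ?_, ?_⟩
  · have ht : a ∉ t := fun h => by simpa using mem_powerset.1 ht h
    simp only [mem_compression_of_notMem ht, insert_mem_compression ht, card_insert_of_notMem ht]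
    by_cases p1 : t ∈ 𝒜 <;> by_cases p2 : insert a t ∈ 𝒜 <;> simp [p1, p2]
  · rw [mem_powerset]
    intro x hx
    simp only [mem_erase, mem_univ, and_true]
    rintro rfl
    exact has hx
  · simp [mem_compression_of_notMem has, insert_mem_compression has, card_insert_of_notMem has,
      hs, hs']

/-- Among the families of a given size, some lower set has energy at least that of a given one. -/
lemma exists_isLowerSet_energy_le [Fintype β] {g : ℕ → ℝ} (hg : Antitone g)
    (𝒜 : Finset (Finset β)) :
    ∃ ℬ : Finset (Finset β), #ℬ = #𝒜 ∧ energy g 𝒜 ≤ energy g ℬ ∧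
      IsLowerSet (ℬ : Set (Finset β)) := by
  induction hN : ∑ s ∈ 𝒜, #s using Nat.strong_induction_on generalizing 𝒜 with
  | _ N ih =>
  by_cases h : ∃ a s, a ∉ s ∧ s ∉ 𝒜 ∧ insert a s ∈ 𝒜
  · obtain ⟨a, s, has, hs, hs'⟩ := h
    obtain ⟨ℬ, h1, h2, h3⟩ := ih _ (hN ▸ sum_card_compression_lt has hs hs') (𝓓 a 𝒜) rfl
    exact ⟨ℬ, h1.trans (Down.card_compression a 𝒜),
      (energy_le_energy_compression hg a 𝒜).trans h2, h3⟩
  · push Not at h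
    refine ⟨𝒜, rfl, le_rfl, ?_⟩
    intro t s hst ht
    induction hk : #(t \ s) generalizing s with
    | zero =>
      rw [card_eq_zero, sdiff_eq_empty_iff_subset] at hk
      rwa [← hk.antisymm hst]
    | succ k ihk =>
      obtain ⟨a, ha⟩ : (t \ s).Nonempty := by rw [← card_pos]; omega
      rw [mem_sdiff] at ha
      have h1 : insert a s ∈ 𝒜 := by
        refine ihk (insert_subset ha.1 hst) ?_
        rw [sdiff_insert, card_erase_of_mem (mem_sdiff.2 ha), hk]
        rfl
      by_contra hs
      exact h a s ha.2 hs h1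

lemma card_filter_sdiff_le [Fintype β] (𝒜 : Finset (Finset β)) (s : Finset β) (i j : ℕ) :
    #{t ∈ 𝒜 | #(s \ t) = i ∧ #(t \ s) = j} ≤ (#s).choose i * (Fintype.card β).choose j := by
  rw [← card_powersetCard, ← card_univ, ← card_powersetCard, ← card_product]
  refine card_le_card_of_injOn (fun t => (s \ t, t \ s)) (fun t ht => ?_) ?_
  · simp only [coe_filter, Set.mem_ofPred_eq] at ht
    simp [mem_powersetCard, ht.2]
  · intro t _ u _ h
    simp only [Prod.mk.injEq, Finset.ext_iff, mem_sdiff] at h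
    ext x
    have := h.1 x
    have := h.2 x
    tauto

lemma card_symmDiff (s t : Finset β) : #(s ∆ t) = #(s \ t) + #(t \ s) := by
  rw [symmDiff_def, sup_eq_union, card_union_of_disjoint disjoint_sdiff_sdiff]

/-- In a family of sets of size at most `l`, few pairs are at Hamming distance `w`. -/
lemma sum_card_symmDiff_eq_le [Fintype β] {l : ℕ} {𝒜 : Finset (Finset β)}
    (h𝒜 : ∀ s ∈ 𝒜, #s ≤ l) (w : ℕ) :
    ∑ s ∈ 𝒜, #{t ∈ 𝒜 | #(s ∆ t) = w} ≤
      2 * (#𝒜 * ∑ ij ∈ antidiagonal w with ij.2 ≤ ij.1,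
        l.choose ij.1 * (Fintype.card β).choose ij.2) := by
  have hhalf : ∑ s ∈ 𝒜, #{t ∈ 𝒜 | #(s ∆ t) = w ∧ #(t \ s) ≤ #(s \ t)} ≤
      #𝒜 * ∑ ij ∈ antidiagonal w with ij.2 ≤ ij.1,
        l.choose ij.1 * (Fintype.card β).choose ij.2 := by
    rw [← smul_eq_mul]
    refine sum_le_card_nsmul _ _ _ fun s hs => ?_
    calc #{t ∈ 𝒜 | #(s ∆ t) = w ∧ #(t \ s) ≤ #(s \ t)}
        ≤ #((antidiagonal w |>.filter fun ij => ij.2 ≤ ij.1).biUnion fun ij =>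
            {t ∈ 𝒜 | #(s \ t) = ij.1 ∧ #(t \ s) = ij.2}) := by
          refine card_le_card fun t ht => ?_
          simp only [mem_filter, card_symmDiff] at ht
          simp only [mem_biUnion, mem_filter, HasAntidiagonal.mem_antidiagonal]
          exact ⟨(#(s \ t), #(t \ s)), ⟨ht.2.1, ht.2.2⟩, ht.1, rfl, rfl⟩
      _ ≤ ∑ ij ∈ antidiagonal w with ij.2 ≤ ij.1,
            #{t ∈ 𝒜 | #(s \ t) = ij.1 ∧ #(t \ s) = ij.2} := card_biUnion_le
      _ ≤ _ := by
          refine sum_le_sum fun ij _ => (card_filter_sdiff_le 𝒜 s _ _).trans ?_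
          exact Nat.mul_le_mul_right _ (Nat.choose_le_choose _ (h𝒜 s hs))
  have hswap : ∑ s ∈ 𝒜, #{t ∈ 𝒜 | #(s ∆ t) = w ∧ #(s \ t) ≤ #(t \ s)} =
      ∑ s ∈ 𝒜, #{t ∈ 𝒜 | #(s ∆ t) = w ∧ #(t \ s) ≤ #(s \ t)} := by
    simp only [card_filter]
    rw [sum_comm]
    simp only [symmDiff_comm]
  calc ∑ s ∈ 𝒜, #{t ∈ 𝒜 | #(s ∆ t) = w}
      ≤ ∑ s ∈ 𝒜, (#{t ∈ 𝒜 | #(s ∆ t) = w ∧ #(t \ s) ≤ #(s \ t)} +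
          #{t ∈ 𝒜 | #(s ∆ t) = w ∧ #(s \ t) ≤ #(t \ s)}) := by
        refine sum_le_sum fun s _ => (card_le_card fun t ht => ?_).trans (card_union_le _ _)
        simp only [mem_union, mem_filter] at ht ⊢
        rcases le_total #(t \ s) #(s \ t) with h | h
        · exact Or.inl ⟨ht.1, ht.2, h⟩
        · exact Or.inr ⟨ht.1, ht.2, h⟩
    _ ≤ _ := by rw [sum_add_distrib, hswap, ← two_mul]; exact Nat.mul_le_mul_left 2 hhalf

end Combinatorics

section Estimates

lemma sum_antidiagonal_inv_factorial (w : ℕ) :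
    ∑ ij ∈ antidiagonal w, (1 : ℝ) / (ij.1.factorial * ij.2.factorial) =
      2 ^ w / w.factorial := by
  have h : (2 : ℝ) ^ w = ∑ ij ∈ antidiagonal w, (w.choose ij.1 : ℝ) := by
    rw [Nat.sum_antidiagonal_eq_sum_range_succ_mk]
    exact_mod_cast (Nat.sum_range_choose w).symm
  rw [h, sum_div]
  refine sum_congr rfl fun ij hij => ?_
  rw [HasAntidiagonal.mem_antidiagonal] at hij
  subst hij
  have h := Nat.add_choose_mul_factorial_mul_factorial ij.1 ij.2
  rw [← h]
  have hc : 0 < (ij.1 + ij.2).choose ij.1 := Nat.choose_pos (Nat.le_add_right _ _)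
  rw [Nat.choose_symm_add] at hc ⊢
  push_cast
  field_simp

lemma pow_mul_pow_le_sqrt_pow {l n i j : ℕ} (hln : l ≤ n) (hji : j ≤ i) :
    (l : ℝ) ^ i * (n : ℝ) ^ j ≤ Real.sqrt ((n : ℝ) * l) ^ (i + j) := by
  obtain ⟨k, rfl⟩ := Nat.exists_eq_add_of_le hji
  have hl : (l : ℝ) ≤ Real.sqrt ((n : ℝ) * l) := by
    refine Real.le_sqrt_of_sq_le ?_
    rw [sq]
    gcongr
  have hs : Real.sqrt ((n : ℝ) * l) ^ 2 = n * l := Real.sq_sqrt (by positivity)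
  calc (l : ℝ) ^ (j + k) * (n : ℝ) ^ j = (l : ℝ) ^ k * ((n : ℝ) * l) ^ j := by ring
    _ ≤ Real.sqrt ((n : ℝ) * l) ^ k * ((n : ℝ) * l) ^ j := by gcongr
    _ = Real.sqrt ((n : ℝ) * l) ^ k * (Real.sqrt ((n : ℝ) * l) ^ 2) ^ j := by rw [hs]
    _ = _ := by ring

lemma sum_choose_mul_choose_le {l n : ℕ} (hln : l ≤ n) (w : ℕ) :
    ((∑ ij ∈ antidiagonal w with ij.2 ≤ ij.1, l.choose ij.1 * n.choose ij.2 : ℕ) : ℝ) ≤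
      (8 * Real.exp 1 * Real.sqrt ((n : ℝ) * l) / w) ^ w := by
  set X := Real.sqrt ((n : ℝ) * l)
  have hX : 0 ≤ X := Real.sqrt_nonneg _
  push_cast
  calc ∑ ij ∈ antidiagonal w with ij.2 ≤ ij.1, (l.choose ij.1 : ℝ) * (n.choose ij.2 : ℝ)
      ≤ ∑ ij ∈ antidiagonal w with ij.2 ≤ ij.1,
          X ^ w * (1 / (ij.1.factorial * ij.2.factorial)) := by
        refine sum_le_sum fun ij hij => ?_
        rw [mem_filter, HasAntidiagonal.mem_antidiagonal] at hij
        have h := pow_mul_pow_le_sqrt_pow hln hij.2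
        rw [hij.1] at h
        calc (l.choose ij.1 : ℝ) * (n.choose ij.2 : ℝ)
            ≤ ((l : ℝ) ^ ij.1 / ij.1.factorial) * ((n : ℝ) ^ ij.2 / ij.2.factorial) := by
              gcongr <;> exact Nat.choose_le_pow_div _ _
          _ = ((l : ℝ) ^ ij.1 * (n : ℝ) ^ ij.2) * (1 / (ij.1.factorial * ij.2.factorial)) := by
              field_simp
          _ ≤ _ := by gcongr
    _ ≤ ∑ ij ∈ antidiagonal w, X ^ w * (1 / (ij.1.factorial * ij.2.factorial)) :=
        sum_le_sum_of_subset_of_nonneg (filter_subset _ _) fun _ _ _ => by positivity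
    _ = X ^ w * (2 ^ w / w.factorial) := by
        rw [← mul_sum, sum_antidiagonal_inv_factorial]
    _ ≤ X ^ w * (8 ^ w * (Real.exp 1 ^ w / (w : ℝ) ^ w)) := by
        gcongr X ^ w * ?_
        have hw : (0 : ℝ) < (w : ℝ) ^ w := by
          rcases Nat.eq_zero_or_pos w with rfl | h
          · simp
          · positivity
        have he : (w : ℝ) ^ w / w.factorial ≤ Real.exp 1 ^ w := by
          rw [← Real.exp_nat_mul, mul_one]
          exact Real.pow_div_factorial_le_exp _ (by positivity) _
        calc (2 : ℝ) ^ w / w.factorial = 2 ^ w * (((w : ℝ) ^ w / w.factorial) / (w : ℝ) ^ w) := by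
              field_simp
          _ ≤ 8 ^ w * (Real.exp 1 ^ w / (w : ℝ) ^ w) := by
              gcongr
              norm_num
    _ = _ := by rw [div_pow, mul_pow, mul_pow]; ring

lemma two_pow_le_bound {l n : ℕ} (hln : l ≤ n) :
    (2 : ℝ) ^ l ≤ (8 * Real.exp 1 * Real.sqrt ((n : ℝ) * l) / l) ^ l := by
  rcases Nat.eq_zero_or_pos l with rfl | h
  · simp
  have hl : (0 : ℝ) < l := by exact_mod_cast h
  have hs : (l : ℝ) ≤ Real.sqrt ((n : ℝ) * l) := by
    refine Real.le_sqrt_of_sq_le ?_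
    rw [sq]
    gcongr
  have he := Real.add_one_le_exp (1 : ℝ)
  gcongr
  rw [le_div_iff₀ hl]
  nlinarith

end Estimates

/-- The energy of a set family of size at most `2 ^ l` in the `n`-cube. -/
lemma energy_le {n l : ℕ} {g : ℕ → ℝ} (hg : Antitone g) (hg0 : ∀ w, 0 ≤ g w) (hln : l ≤ n)
    (𝒜 : Finset (Finset (Fin n))) (h𝒜 : #𝒜 ≤ 2 ^ l) :
    energy g 𝒜 ≤ #𝒜 * ∑ w ∈ range (l + 1),
      2 * (8 * Real.exp 1 * Real.sqrt ((n : ℝ) * l) / w) ^ w * g w := by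
  obtain ⟨ℬ, hcard, hle, hlow⟩ := exists_isLowerSet_energy_le hg 𝒜
  refine hle.trans ?_
  rw [← hcard] at h𝒜 ⊢
  have hsize : ∀ s ∈ ℬ, #s ≤ l := fun s hs =>
    (Nat.pow_le_pow_iff_right one_lt_two).1 ((two_pow_card_le_of_mem hlow hs).trans h𝒜)
  have hpt (d : ℕ) : g d ≤ (∑ w ∈ range l, if d = w then g w else 0) + g l := by
    rcases lt_or_ge d l with h | h
    · simp [h, hg0 l]
    · simpa [not_lt.2 h] using hg h
  calc energy g ℬ
      ≤ ∑ s ∈ ℬ, ∑ t ∈ ℬ, ((∑ w ∈ range l, if #(s ∆ t) = w then g w else 0) + g l) :=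
        sum_le_sum fun s _ => sum_le_sum fun t _ => hpt _
    _ = ∑ w ∈ range l, ((∑ s ∈ ℬ, #{t ∈ ℬ | #(s ∆ t) = w} : ℕ) : ℝ) * g w +
          #ℬ * (#ℬ * g l) := by
        simp only [sum_add_distrib, sum_const, nsmul_eq_mul]
        congr 1
        simp only [Nat.cast_sum, card_filter, Nat.cast_ite, Nat.cast_one, Nat.cast_zero, sum_mul,
          ite_mul, one_mul, zero_mul]
        rw [sum_comm (s := range l)]
        exact sum_congr rfl fun s _ => sum_comm
    _ ≤ ∑ w ∈ range l, (#ℬ : ℝ) *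
            (2 * (8 * Real.exp 1 * Real.sqrt ((n : ℝ) * l) / w) ^ w * g w) +
          #ℬ * (2 * (8 * Real.exp 1 * Real.sqrt ((n : ℝ) * l) / l) ^ l * g l) := by
        refine add_le_add (sum_le_sum fun w _ => ?_) ?_
        · have h1 : ((∑ s ∈ ℬ, #{t ∈ ℬ | #(s ∆ t) = w} : ℕ) : ℝ) ≤ 2 * (#ℬ *
              ((∑ ij ∈ antidiagonal w with ij.2 ≤ ij.1, l.choose ij.1 * n.choose ij.2 : ℕ) : ℝ)) := by
            have h := sum_card_symmDiff_eq_le hsize w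
            rw [Fintype.card_fin] at h
            exact_mod_cast h
          have h2 := sum_choose_mul_choose_le hln w
          calc _ ≤ (2 * (#ℬ * (8 * Real.exp 1 * Real.sqrt ((n : ℝ) * l) / w) ^ w)) * g w := by
                refine mul_le_mul_of_nonneg_right (h1.trans ?_) (hg0 w)
                gcongr
            _ = _ := by ring
        · have h1 : (#ℬ : ℝ) ≤ 2 ^ l := by exact_mod_cast h𝒜
          have h2 := two_pow_le_bound hln
          have h3 : (0 : ℝ) < 2 ^ l := by positivity
          refine mul_le_mul_of_nonneg_left (mul_le_mul_of_nonneg_right ?_ (hg0 l)) (by positivity)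
          linarith
    _ = _ := by rw [sum_range_succ, mul_add, mul_sum]

section Probability

lemma integral_bernoulliMeasure_zmod (p : unitInterval) (f : ZMod 2 → ℝ) :
    ∫ x, f x ∂(bernoulliMeasure (1 : ZMod 2) 0 p) = p * f 1 + (1 - p) * f 0 := by
  rw [integral_bernoulliMeasure]
  all_goals simp

/-- The nontrivial character of `ZMod 2`. -/
def sign (a : ZMod 2) : ℝ := if a = 0 then 1 else -1

lemma sign_add (a b : ZMod 2) : sign (a + b) = sign a * sign b := by
  have h : ∀ x : ZMod 2, x = 0 ∨ x = 1 := by decide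
  have h2 : (1 + 1 : ZMod 2) = 0 := by decide
  rcases h a with rfl | rfl <;> rcases h b with rfl | rfl <;> simp [sign, h2]

lemma sign_sum {ι : Type*} (s : Finset ι) (f : ι → ZMod 2) :
    sign (∑ i ∈ s, f i) = ∏ i ∈ s, sign (f i) := by
  classical
  induction s using Finset.induction_on with
  | empty => simp [sign]
  | insert a s ha ih => rw [sum_insert ha, prod_insert ha, sign_add, ih]

lemma indicator_eq_zero_eq_sign (a : ZMod 2) :
    (if a = 0 then 1 else 0 : ℝ) = 1 / 2 + 1 / 2 * sign a := by
  unfold sign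
  split_ifs <;> norm_num

/-- The support of a vector over `ZMod 2`. -/
def supp {n : ℕ} (x : Fin n → ZMod 2) : Finset (Fin n) := {i | x i ≠ 0}

lemma supp_injective {n : ℕ} : Function.Injective (supp (n := n)) := by
  intro x y h
  funext i
  have h2 : ∀ a b : ZMod 2, (a ≠ 0 ↔ b ≠ 0) → a = b := by decide
  exact h2 _ _ (by simpa [supp] using Finset.ext_iff.1 h i)

lemma supp_sub {n : ℕ} (x y : Fin n → ZMod 2) : supp (x - y) = supp x ∆ supp y := by
  ext i
  have h2 : ∀ a b : ZMod 2, (a - b ≠ 0) ↔ (a ≠ 0 ∧ ¬ b ≠ 0 ∨ b ≠ 0 ∧ ¬ a ≠ 0) := by decide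
  simpa [supp, mem_symmDiff] using h2 (x i) (y i)

/-- The probability that a random row with independent Bernoulli entries is orthogonal to `z`. -/
lemma integral_row_orthogonal {n : ℕ} (p : unitInterval) (z : Fin n → ZMod 2) :
    ∫ a, (if ∑ j, a j * z j = 0 then 1 else 0 : ℝ)
        ∂(Measure.pi fun _ : Fin n => bernoulliMeasure (1 : ZMod 2) 0 p) =
      1 / 2 + 1 / 2 * (1 - 2 * (p : ℝ)) ^ #(supp z) := by
  simp only [indicator_eq_zero_eq_sign, sign_sum]
  rw [integral_add .of_finite .of_finite, integral_const_mul,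
    integral_fintype_prod_eq_prod (fun j a => sign (a * z j))]
  simp only [integral_bernoulliMeasure_zmod, integral_const, probReal_univ, one_smul]
  congr 2
  rw [supp, ← prod_const, prod_filter]
  refine prod_congr rfl fun j _ => ?_
  by_cases h : z j = 0
  · simp [h, sign]
  · simp [h, sign]; ring

lemma prod_castLE {n m : ℕ} (hm : m ≤ n) (f : Fin n → ℝ) :
    ∏ j : Fin m, f (Fin.castLE hm j) = ∏ i : Fin n, if (i : ℕ) < m then f i else 1 := by
  rw [← prod_filter]
  refine prod_bij (fun j _ => Fin.castLE hm j) (fun j _ => by simp) (fun a _ b _ h => by simpa using h)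
    (fun b hb => ⟨⟨b, by simpa using hb⟩, mem_univ _, rfl⟩) fun _ _ => rfl

/-- The indicator of the event that `y` lies in the cell. -/
noncomputable def hit {n m : ℕ} (hm : m ≤ n) (α y : Fin n → ZMod 2) (ω : Seed n) : ℝ :=
  if slice hm (hash ω y) = slice hm α then 1 else 0

lemma cnt_eq_sum_hit {n m : ℕ} (hm : m ≤ n) (S : Finset (Fin n → ZMod 2)) (α : Fin n → ZMod 2)
    (ω : Seed n) : cnt hm S α ω = ∑ y ∈ S, hit hm α y ω := by
  simp [cnt, cell, hit]

lemma hit_mul_hit {n m : ℕ} (hm : m ≤ n) (α x y : Fin n → ZMod 2) (A : Fin n → Fin n → ZMod 2)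
    (b : Fin n → ZMod 2) :
    hit hm α x (A, b) * hit hm α y (A, b) =
      (∏ i : Fin n, if (i : ℕ) < m then
        (if ∑ j, A i j * (x - y) j = 0 then 1 else 0 : ℝ) else 1) *
      ∏ i : Fin n, if (i : ℕ) < m then
        (if b i = α i - ∑ j, A i j * x j then 1 else 0 : ℝ) else 1 := by
  rw [← prod_castLE hm (fun i => (if ∑ j, A i j * (x - y) j = 0 then 1 else 0 : ℝ)),
    ← prod_castLE hm (fun i => (if b i = α i - ∑ j, A i j * x j then 1 else 0 : ℝ)),
    ← prod_mul_distrib]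
  simp only [hit, mul_ite, mul_one, mul_zero, ← ite_and, Fintype.prod_ite_zero, prod_const_one]
  refine if_congr ?_ rfl rfl
  rw [funext_iff, funext_iff, ← forall_and]
  refine forall_congr' fun i => ?_
  simp only [slice, hash, Pi.add_apply, Matrix.mulVec, dotProduct, Matrix.of_apply, Pi.sub_apply,
    mul_sub, sum_sub_distrib]
  generalize ∑ j, A (Fin.castLE hm i) j * x j = u
  generalize ∑ j, A (Fin.castLE hm i) j * y j = v
  generalize b (Fin.castLE hm i) = c
  generalize α (Fin.castLE hm i) = d
  revert u v c d
  decide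

instance {n : ℕ} (p : Fin n → unitInterval) : IsProbabilityMeasure (seedLaw p) := by
  unfold seedLaw; infer_instance

/-- The probability that two given points both lie in the cell. -/
lemma integral_hit_mul_hit {n m : ℕ} (p : Fin n → unitInterval) (hm : m ≤ n)
    (α x y : Fin n → ZMod 2) :
    ∫ ω, hit hm α x ω * hit hm α y ω ∂(seedLaw p) =
      q p hm #(supp x ∆ supp y) * (1 / 2 ^ m) := by
  have hb (A : Fin n → Fin n → ZMod 2) :
      ∫ b, (∏ i : Fin n, if (i : ℕ) < m then
        (if b i = α i - ∑ j, A i j * x j then 1 else 0 : ℝ) else 1)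
        ∂(Measure.pi fun _ : Fin n => bernoulliMeasure (1 : ZMod 2) 0 half) = 1 / 2 ^ m := by
    rw [integral_fintype_prod_eq_prod (fun (i : Fin n) (b : ZMod 2) => if (i : ℕ) < m then
        (if b = α i - ∑ j, A i j * x j then 1 else 0 : ℝ) else 1)]
    have h (c : ZMod 2) : (1 / 2 : ℝ) * (if 1 = c then 1 else 0) +
        (1 - 1 / 2) * (if 0 = c then 1 else 0) = 1 / 2 := by
      have h : ∀ x : ZMod 2, x = 0 ∨ x = 1 := by decide
      rcases h c with rfl | rfl <;> norm_num
    calc _ = ∏ i : Fin n, if (i : ℕ) < m then (1 / 2 : ℝ) else 1 := by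
          refine prod_congr rfl fun i _ => ?_
          split_ifs
          · rw [integral_bernoulliMeasure_zmod]; exact h _
          · simp
      _ = _ := by
          rw [← prod_castLE hm (fun _ => (1 / 2 : ℝ))]
          simp
  rw [seedLaw, integral_prod _ .of_finite]
  simp only [hit_mul_hit, integral_const_mul, hb, integral_mul_const]
  congr 1
  rw [integral_fintype_prod_eq_prod (fun (i : Fin n) (a : Fin n → ZMod 2) => if (i : ℕ) < m then
        (if ∑ j, a j * (x - y) j = 0 then 1 else 0 : ℝ) else 1), q,
    prod_castLE hm (fun i => 1 / 2 + 1 / 2 * (1 - 2 * (p i : ℝ)) ^ #(supp x ∆ supp y))]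
  refine prod_congr rfl fun i _ => ?_
  split_ifs
  · rw [integral_row_orthogonal, supp_sub]
  · simp

lemma integral_hit {n m : ℕ} (p : Fin n → unitInterval) (hm : m ≤ n) (α x : Fin n → ZMod 2) :
    ∫ ω, hit hm α x ω ∂(seedLaw p) = 1 / 2 ^ m := by
  have h := integral_hit_mul_hit p hm α x x
  have h' (ω : Seed n) : hit hm α x ω * hit hm α x ω = hit hm α x ω := by
    unfold hit; split_ifs <;> simp
  simp only [h'] at h
  rw [h]
  simp [q]
  norm_num

lemma integral_cnt {n m : ℕ} (p : Fin n → unitInterval) (hm : m ≤ n)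
    (S : Finset (Fin n → ZMod 2)) (α : Fin n → ZMod 2) :
    ∫ ω, cnt hm S α ω ∂(seedLaw p) = #S * (1 / 2 ^ m) := by
  simp only [cnt_eq_sum_hit]
  rw [integral_finsetSum _ fun _ _ => .of_finite]
  simp [integral_hit]

lemma variance_cnt {n m : ℕ} (p : Fin n → unitInterval) (hm : m ≤ n)
    (S : Finset (Fin n → ZMod 2)) (α : Fin n → ZMod 2) :
    variance (cnt hm S α) (seedLaw p) =
      (∑ x ∈ S, ∑ y ∈ S, r p hm #(supp x ∆ supp y)) * (1 / 2 ^ m) := by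
  rw [variance_eq_sub .of_discrete, integral_cnt]
  have h : ∫ ω, (cnt hm S α ^ 2) ω ∂(seedLaw p) =
      ∑ x ∈ S, ∑ y ∈ S, q p hm #(supp x ∆ supp y) * (1 / 2 ^ m) := by
    simp only [Pi.pow_apply, cnt_eq_sum_hit, sq, sum_mul_sum]
    rw [integral_finsetSum _ fun _ _ => .of_finite]
    refine sum_congr rfl fun x _ => ?_
    rw [integral_finsetSum _ fun _ _ => .of_finite]
    exact sum_congr rfl fun y _ => integral_hit_mul_hit p hm α x y
  rw [h]
  simp only [r, sum_sub_distrib, sum_const, nsmul_eq_mul, ← sum_mul]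
  ring

lemma r_antitone {n m : ℕ} {p : Fin n → unitInterval} (hp : ∀ i, (p i : ℝ) ≤ 1 / 2)
    (hm : m ≤ n) : Antitone (r p hm) := by
  intro v w hvw
  refine sub_le_sub_right (prod_le_prod (fun j _ => ?_) fun j _ => ?_) _
  · have := hp (Fin.castLE hm j)
    have : 0 ≤ (1 - 2 * (p (Fin.castLE hm j) : ℝ)) ^ w := pow_nonneg (by linarith) _
    linarith
  · have := hp (Fin.castLE hm j)
    have h0 := (p (Fin.castLE hm j)).2.1
    have := pow_le_pow_of_le_one (a := 1 - 2 * (p (Fin.castLE hm j) : ℝ)) (by linarith)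
      (by linarith) hvw
    linarith

lemma r_nonneg {n m : ℕ} {p : Fin n → unitInterval} (hp : ∀ i, (p i : ℝ) ≤ 1 / 2)
    (hm : m ≤ n) (w : ℕ) : 0 ≤ r p hm w := by
  rw [r, sub_nonneg, q]
  calc (1 : ℝ) / 2 ^ m = ∏ _j : Fin m, (1 / 2 : ℝ) := by simp
    _ ≤ _ := by
      refine prod_le_prod (fun _ _ => by norm_num) fun j _ => ?_
      have := hp (Fin.castLE hm j)
      have : 0 ≤ (1 - 2 * (p (Fin.castLE hm j) : ℝ)) ^ w := pow_nonneg (by linarith) _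
      linarith

end Probability

lemma card_le_two_pow_ell {n : ℕ} {S : Finset (Fin n → ZMod 2)} (hS : S.Nonempty) :
    #S ≤ 2 ^ ell S := by
  have hpos : (0 : ℝ) < #S := by exact_mod_cast hS.card_pos
  have h := (Real.logb_le_iff_le_rpow one_lt_two hpos).1 (Nat.le_ceil (Real.logb 2 (#S : ℝ)))
  rw [Real.rpow_natCast, ← ell] at h
  exact_mod_cast h

lemma ell_le {n : ℕ} {S : Finset (Fin n → ZMod 2)} (hS : S.Nonempty) : ell S ≤ n := by
  have hpos : (0 : ℝ) < #S := by exact_mod_cast hS.card_pos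
  refine Nat.ceil_le.2 ((Real.logb_le_iff_le_rpow one_lt_two hpos).2 ?_)
  rw [Real.rpow_natCast]
  have h : #S ≤ 2 ^ n := by simpa using card_le_univ S
  exact_mod_cast h

end SparseHash

/-- The summand for `w = 0` is `2 * r(0,m)`: the power with exponent `0` is `1`. -/
theorem theorem1 (n m : ℕ) (hm1 : 1 ≤ m) (hmn : m ≤ n)
    (p : Fin n → unitInterval) (hp0 : ∀ i, 0 < (p i : ℝ)) (hp : ∀ i, (p i : ℝ) ≤ 1 / 2)
    (S : Finset (Fin n → ZMod 2)) (hS : S.Nonempty) (α : Fin n → ZMod 2) :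
    variance (SparseHash.cnt hmn S α) (SparseHash.seedLaw p) /
        (∫ ω, SparseHash.cnt hmn S α ω ∂(SparseHash.seedLaw p)) ≤
      ∑ w ∈ Finset.range (SparseHash.ell S + 1),
        2 * (8 * Real.exp 1 * Real.sqrt ((n : ℝ) * (SparseHash.ell S : ℝ)) / (w : ℝ)) ^ w *
          SparseHash.r p hmn w := by
  have hpos : (0 : ℝ) < S.card := by exact_mod_cast hS.card_pos
  have henergy : ∑ x ∈ S, ∑ y ∈ S,
      SparseHash.r p hmn (symmDiff (SparseHash.supp x) (SparseHash.supp y)).card =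
      SparseHash.energy (SparseHash.r p hmn) (S.image SparseHash.supp) := by
    simp only [SparseHash.energy, Finset.sum_image SparseHash.supp_injective.injOn]
  have hcard : (S.image SparseHash.supp).card = S.card :=
    Finset.card_image_of_injective S SparseHash.supp_injective
  have h := SparseHash.energy_le (SparseHash.r_antitone hp hmn) (SparseHash.r_nonneg hp hmn)
    (SparseHash.ell_le hS) (S.image SparseHash.supp)
    (hcard.le.trans (SparseHash.card_le_two_pow_ell hS))
  rw [hcard] at h
  rw [SparseHash.variance_cnt, SparseHash.integral_cnt, henergy,
    mul_div_mul_right _ _ (by positivity), div_le_iff₀ hpos, mul_comm _ (S.card : ℝ)]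
  exact h
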